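/- Elements of a linearly ordered set arrive as a finite stream $I$. A machine with a buffer of $M\ge 1$ slots reads $I$ in order into free slots of the buffer; when it writes, it removes an element from the buffer and appends it to the output $S$, until every element has been written. A run is a sorted or reverse-sorted sequence, $R(S)$ is the least number of runs whose concatenation is $S$, and $\mathrm{OPT}(I)$ is the minimum of $R(S)$ over all outputs $S$ that a machine with an $M$-slot buffer can produce on $I$ (knowing all of $I$ in advance). At any time, the unwritten-element sequence consists of the buffer contents, in order of arrival, followed by the input not yet read. A deterministic online algorithm with an $M$-size buffer and $4M$-visibility (that is, $3M$-lookahead) refills each freed slot with the next input element; it chooses the buffer element to write, and its next internal state, from its current internal state, the last element written (if any) and the first $4M$ elements of the unwritten-element sequence only. A maximal up run starts with the smallest element in the buffer, always continues with the smallest buffer element larger than the last element written, and ends only when there is none; maximal down runs are defined symmetrically. **Theorem.** For every $M\ge 1$ there is a deterministic online algorithm $A$ with an $M$-size buffer, $4M$-visibility and a finite set of internal states that does not depend on $M$, such that for every input $I$ without duplicate elements the output $S$ of $A$ on $I$ satisfies $$R(S)\le \tfrac32\,\mathrm{OPT}(I).$$ Moreover, $A$ works in rounds until no element is left: in each round it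 writes the greedy run (the longer of the maximal up run and the maximal down run on the current unwritten-element sequence; either one in case of a tie), then a maximal run in the same direction, then a maximal run in the opposite direction (runs may be empty once no element is left). -/

import Mathlib

namespace RunGeneration

/-! ### Runs, outputs of a machine with a buffer of size `M`, and `OPT` -/

/-- A run: a sorted or reverse-sorted sequence. -/
def IsRun {α : Type*} [LinearOrder α] (L : List α) : Prop :=
  L.Pairwise (· ≤ ·) ∨ L.Pairwise (· ≥ ·)

/-- `R(S)`: the least number of runs whose concatenation is `S`. -/
noncomputable def numRuns {α : Type*} [LinearOrder α] (S : List α) : ℕ :=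
  sInf {k : ℕ | ∃ P : List (List α), P.length = k ∧ P.flatten = S ∧ ∀ r ∈ P, IsRun r}

/-- `Produces M B I S`: with buffer contents `B` and remaining input `I`, a machine whose buffer has
`M` slots can write the sequence `S` and finish.  It reads the input in order, into free slots only,
and writes elements of its buffer (each write frees a slot).  Slots may be left free. -/
inductive Produces {α : Type*} [LinearOrder α] (M : ℕ) : List α → List α → List α → Prop
  | done : Produces M [] [] []
  | read {B I S : List α} {x : α} :
      B.length < M → Produces M (B ++ [x]) I S → Produces M B (x :: I) S
  | write {B I S : List α} {e : α} :
      e ∈ B → Produces M (B.erase e) I S → Produces M B I (e :: S)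

/-- `OPT(I)`: the least number of runs of an output sequence on input `I` with an `M`-size buffer. -/
noncomputable def opt {α : Type*} [LinearOrder α] (M : ℕ) (I : List α) : ℕ :=
  sInf {k : ℕ | ∃ S : List α, Produces M [] I S ∧ numRuns S = k}

/-! ### Deterministic online algorithms with visibility -/

/-- A deterministic online algorithm with an `M`-size buffer, `V`-visibility and internal states `σ`.

The algorithm always refills a freed slot with the next input element.  So, if the unwritten-element
sequence `U` lists the buffer in order of arrival and then the remaining input, the buffer is
`U.take M`, and the visible part is `U.take V`.  When it has to write, the algorithm knows its
state, the last element written (if any) and the visible part `w` of `U`, and nothing else;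
from these it determines the buffer slot to eject and its next state. -/
structure OnlineAlgorithm (α σ : Type*) (M V : ℕ) where
  /-- the initial state -/
  init : σ
  /-- the next state -/
  next : σ → Option α → List α → σ
  /-- the buffer slot from which an element is written -/
  slot : σ → Option α → List α → ℕ
  /-- only an element that is in the buffer can be written -/
  slot_lt : ∀ (s : σ) (last : Option α) (w : List α), w ≠ [] → slot s last w < (w.take M).length

/-- What there is at a time step: state, unwritten-element sequence, output written so far. -/
structure Config (α σ : Type*) where
  state : σ
  unwritten : List α
  written : List α

/-- One time step: one element is written (nothing happens once everything has been written). -/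
def OnlineAlgorithm.step {α σ : Type*} {M V : ℕ} (A : OnlineAlgorithm α σ M V)
    (c : Config α σ) : Config α σ :=
  let last := c.written.getLast?
  let w := c.unwritten.take V
  match c.unwritten[A.slot c.state last w]? with
  | none => c
  | some e =>
    { state := A.next c.state last w
      unwritten := c.unwritten.eraseIdx (A.slot c.state last w)
      written := c.written ++ [e] }

/-- The output on input `I`: what has been written after as many time steps as `I` has elements. -/
def OnlineAlgorithm.output {α σ : Type*} {M V : ℕ} (A : OnlineAlgorithm α σ M V)
    (I : List α) : List α :=
  (A.step^[I.length] { state := A.init, unwritten := I, written := [] }).written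

/-! ### Maximal runs and the shape of the output -/

/-- The direction of a run. -/
inductive Dir
  | up
  | down

/-- The opposite direction. -/
def Dir.opp : Dir → Dir
  | .up => .down
  | .down => .up

/-- `d.next last B`: the next element of a maximal run in direction `d` with last element `last`
(`none` if the run has just begun), from buffer `B`.  For an up run it is the smallest element of
the buffer that is larger than the last one; for a down run the largest that is smaller.
It is `none` if no element of the buffer can continue the run. -/
def Dir.next {α : Type*} [LinearOrder α] (d : Dir) (last : Option α) (B : List α) : Option α :=
  match d with
  | .up => (B.filter fun x => decide (∀ l ∈ last, l < x)).min?
  | .down => (B.filter fun x => decide (∀ l ∈ last, x < l)).max?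

/-- The (at most `n`) next elements of a maximal run with last element `last`, where the
unwritten-element sequence is `U` and the buffer is `U.take M`. -/
def maximalRunFrom {α : Type*} [LinearOrder α] (M : ℕ) (d : Dir) :
    ℕ → Option α → List α → List α
  | 0, _, _ => []
  | n + 1, last, U =>
    match d.next last (U.take M) with
    | none => []
    | some e => e :: maximalRunFrom M d n (some e) (U.erase e)

/-- The maximal run in direction `d`, started when the unwritten-element sequence is `U`. -/
def maximalRun {α : Type*} [LinearOrder α] (M : ℕ) (d : Dir) (U : List α) : List α :=
  maximalRunFrom M d U.length none U

/-- The unwritten-element sequence after that run. -/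
def afterRun {α : Type*} [LinearOrder α] (M : ℕ) (d : Dir) (U : List α) : List α :=
  U.diff (maximalRun M d U)

/-- `GreedyTriples M U S`: from the unwritten-element sequence `U`, the output `S` is written in
rounds, until no element is left.  A round consists of a greedy run (a maximal run in a direction `d`
in which it is at least as long as in the other), a maximal run in the same direction `d`, and a
maximal run in the opposite direction.  (Runs are empty if no element is left.) -/
inductive GreedyTriples {α : Type*} [LinearOrder α] (M : ℕ) : List α → List α → Prop
  | done : GreedyTriples M [] []
  | round {U S : List α} (d : Dir) :
      U ≠ [] →
      (maximalRun M d.opp U).length ≤ (maximalRun M d U).length →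
      GreedyTriples M (afterRun M d.opp (afterRun M d (afterRun M d U))) S →
      GreedyTriples M U
        (maximalRun M d U ++ maximalRun M d (afterRun M d U) ++
          maximalRun M d.opp (afterRun M d (afterRun M d U)) ++ S)

end RunGeneration

namespace RunGeneration

/-! The core is a covering statement, `Sched.mem_three_runs`: whatever two consecutive runs a
machine can write from the current unwritten sequence, the three runs of a round write all their
elements. Deleting elements keeps a schedule feasible (`Sched.filter`), so an optimal output,
restricted to what a round leaves over, is feasible with two runs fewer. If a single run remains,
the greedy run alone finishes. Induction over rounds gives the ratio 3/2
(`GreedyTriples.two_mul_numRuns_le`).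

Feasibility is treated as counting (`Sched`): an element can be written when fewer than `M` earlier
arrivals are unwritten. Hence a maximal run contains every run in its direction that can start at
the same time (`Sched.subset_maximalRun`). Let `r` be the greedy run, in direction `d`, `s` the next
maximal run in direction `d`, and `p` the maximal run opposite to `r`. Since `p` is no longer than
`r`, whatever `p` writes is written by `r` or is in the buffer after `r`, so `r` and `s` cover `p`
(`mem_two_runs_of_mem_opp`). They also cover any run in direction `d` that follows `p`
(`mem_two_runs_of_opp_then_same`): a first missed element would have too many unwritten predecessors
after `r` compared with `p`. A second run in direction `d.opp` is caught by the third run of the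
round.

For visibility, two opposite runs cannot both reach length `3 * M` when enough input is left
(`min_length_lt_of_opp`), and the first `3 * M` elements of a maximal run are determined by the
window. So comparing lengths inside the window picks a greedy direction. -/

variable {α : Type*} [LinearOrder α]

/-! ### The order in which a run in a given direction is written -/

/-- `d.lt a b`: in direction `d`, the element `a` comes strictly before `b`. -/
def Dir.lt (d : Dir) (a b : α) : Prop :=
  match d with
  | .up => a < b
  | .down => b < a

instance Dir.decidableLT (d : Dir) (a b : α) : Decidable (d.lt a b) :=
  match d with
  | .up => inferInstanceAs (Decidable (a < b))
  | .down => inferInstanceAs (Decidable (b < a))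

theorem Dir.opp_lt {d : Dir} {a b : α} : d.opp.lt a b ↔ d.lt b a := by
  cases d <;> rfl

theorem Dir.lt_irrefl (d : Dir) (a : α) : ¬ d.lt a a := by
  cases d <;> simp [Dir.lt]

theorem Dir.lt_trans {d : Dir} {a b c : α} (h : d.lt a b) (h' : d.lt b c) : d.lt a c := by
  cases d
  · exact _root_.lt_trans h h'
  · exact _root_.lt_trans h' h

theorem Dir.lt_or_gt_of_ne (d : Dir) {a b : α} (h : a ≠ b) : d.lt a b ∨ d.lt b a := by
  cases d
  · exact _root_.lt_or_gt_of_ne h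
  · exact (_root_.lt_or_gt_of_ne h).symm

theorem Dir.next_eq_none {d : Dir} {last : Option α} {B : List α} :
    d.next last B = none ↔ ∀ x ∈ B, ¬ ∀ l ∈ last, d.lt l x := by
  cases d <;> simp [Dir.next, Dir.lt, List.min?_eq_none_iff, List.max?_eq_none_iff]

theorem Dir.next_eq_some {d : Dir} {last : Option α} {B : List α} {e : α}
    (h : d.next last B = some e) :
    e ∈ B ∧ (∀ l ∈ last, d.lt l e) ∧ ∀ x ∈ B, (∀ l ∈ last, d.lt l x) → ¬ d.lt x e := by
  cases d
  · simp only [Dir.next, List.min?_eq_some_iff, List.mem_filter, decide_eq_true_eq] at h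
    exact ⟨h.1.1, h.1.2, fun x hx hl => not_lt.2 (h.2 x ⟨hx, hl⟩)⟩
  · simp only [Dir.next, List.max?_eq_some_iff, List.mem_filter, decide_eq_true_eq] at h
    exact ⟨h.1.1, h.1.2, fun x hx hl => not_lt.2 (h.2 x ⟨hx, hl⟩)⟩

/-! ### Arrival order -/

/-- The elements that precede the first occurrence of `x` in `U`. -/
def preceding : List α → α → Finset α
  | [], _ => ∅
  | a :: U, x => if a = x then ∅ else insert a (preceding U x)

theorem mem_of_mem_preceding {U : List α} {x y : α} (h : y ∈ preceding U x) : y ∈ U := by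
  induction U with
  | nil => simp [preceding] at h
  | cons a U ih =>
    rw [preceding] at h
    split_ifs at h with hax
    · simp at h
    · rcases Finset.mem_insert.1 h with rfl | h
      · simp
      · exact List.mem_cons_of_mem _ (ih h)

theorem preceding_filter {U : List α} {x : α} {p : α → Bool} (hx : p x) :
    preceding (U.filter p) x = (preceding U x).filter (fun y => p y) := by
  induction U with
  | nil => simp [preceding]
  | cons a U ih =>
    by_cases hax : a = x
    · subst hax
      simp [preceding, hx]
    · by_cases ha : p a <;> simp [preceding, hax, ha, ih, Finset.filter_insert]

theorem preceding_subset {U : List α} {x y : α} (h : x ∈ preceding U y) :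
    preceding U x ⊆ preceding U y := by
  induction U with
  | nil => simp [preceding]
  | cons a U ih =>
    rw [preceding] at h
    split_ifs at h with hay
    · simp at h
    · by_cases hax : a = x
      · simp [preceding, hax]
      · have : x ∈ preceding U y := by
          rcases Finset.mem_insert.1 h with h | h
          · exact absurd h.symm hax
          · exact h
        simp only [preceding, hax, hay, if_false]
        exact Finset.insert_subset_insert _ (ih this)

theorem preceding_total {U : List α} {x y : α} (hx : x ∈ U) (hne : x ≠ y) :
    x ∈ preceding U y ∨ y ∈ preceding U x := by
  induction U with
  | nil => simp at hx
  | cons a U ih =>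
    by_cases hax : a = x
    · subst hax
      left
      simp [preceding, hne]
    · by_cases hay : a = y
      · subst hay
        right
        simp [preceding, Ne.symm hne]
      · have : x ∈ U := by
          rcases List.mem_cons.1 hx with h | h
          · exact absurd h.symm hax
          · exact h
        simp only [preceding, hax, hay, if_false, Finset.mem_insert]
        rcases ih this with h | h
        · exact Or.inl (Or.inr h)
        · exact Or.inr (Or.inr h)

/-- Turns membership in the buffer into a cardinality bound, the form in which all later arguments
use it. -/
theorem mem_take_iff {U : List α} (hU : U.Nodup) {M : ℕ} {x : α} :
    x ∈ U.take M ↔ x ∈ U ∧ (preceding U x).card < M := by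
  induction U generalizing M with
  | nil => simp
  | cons a U ih =>
    rw [List.nodup_cons] at hU
    cases M with
    | zero => simp
    | succ M =>
      by_cases hax : a = x
      · subst hax
        simp [preceding]
      · have h : a ∉ preceding U x := fun h => hU.1 (mem_of_mem_preceding h)
        simp [preceding, hax, Ne.symm hax, ih hU.2, Finset.card_insert_of_notMem h]

/-! ### Sequences that a machine with a buffer of size `M` can write -/

/-- `Sched M U S`: a machine with a buffer of size `M` can begin to write the distinct elements
of `S`, in this order, when the unwritten-element sequence is `U`.  It may stop early. -/
def Sched (M : ℕ) (U S : List α) : Prop :=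
  S.Nodup ∧ ∀ S₁ e S₂, S = S₁ ++ e :: S₂ →
    e ∈ U ∧ (preceding U e \ S₁.toFinset).card < M

theorem Sched.nil (M : ℕ) (U : List α) : Sched M U [] :=
  ⟨List.nodup_nil, fun S₁ e S₂ h => by simp at h⟩

theorem Sched.subset {M : ℕ} {U S : List α} (h : Sched M U S) : S ⊆ U := by
  intro e he
  obtain ⟨S₁, S₂, hS⟩ := List.append_of_mem he
  exact (h.2 S₁ e S₂ hS).1

theorem Sched.cons {M : ℕ} {U S : List α} {e : α} (hU : U.Nodup) (he : e ∈ U.take M)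
    (h : Sched M (U.erase e) S) : Sched M U (e :: S) := by
  have heS : e ∉ S := fun heS => hU.not_mem_erase (h.subset heS)
  refine ⟨List.nodup_cons.2 ⟨heS, h.1⟩, fun S₁ y S₂ hS => ?_⟩
  rcases S₁ with _ | ⟨a, S₁⟩
  · obtain ⟨rfl, -⟩ := List.cons.inj hS
    simpa using (mem_take_iff hU).1 he
  · obtain ⟨rfl, hS'⟩ : e = a ∧ S = S₁ ++ y :: S₂ := by simpa using hS
    obtain ⟨h₁, h₂⟩ := h.2 S₁ y S₂ hS'
    have hye : y ≠ e := by
      rintro rfl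
      exact heS (by simp [hS'])
    refine ⟨List.mem_of_mem_erase h₁, lt_of_le_of_lt (Finset.card_le_card ?_) h₂⟩
    rw [hU.erase_eq_filter, preceding_filter (by simpa using hye)]
    intro z
    simp
    tauto

/-- An element dropped from `S` is dropped from `U` too, so no surviving element gains an unwritten
predecessor. This monotonicity replaces any simulation of one machine by another. -/
theorem Sched.filter {M : ℕ} {U S : List α} (h : Sched M U S) (p : α → Bool) :
    Sched M (U.filter p) (S.filter p) := by
  refine ⟨h.1.filter _, fun S₁ e S₂ hS => ?_⟩
  obtain ⟨T₁, T₂, rfl, rfl, hT⟩ := List.filter_eq_append_iff.1 hS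
  obtain ⟨T₃, T₄, rfl, hT₃, he, -⟩ := List.filter_eq_cons_iff.1 hT
  obtain ⟨h₁, h₂⟩ := h.2 (T₁ ++ T₃) e T₄ (by simp)
  refine ⟨List.mem_filter.2 ⟨h₁, he⟩, lt_of_le_of_lt (Finset.card_le_card ?_) h₂⟩
  rw [preceding_filter he]
  intro z
  have := hT₃ z
  simp only [Finset.mem_sdiff, Finset.mem_filter, List.mem_toFinset, List.mem_append,
    List.mem_filter]
  tauto

theorem Sched.append_left {M : ℕ} {U S T : List α} (h : Sched M U (S ++ T)) : Sched M U S := by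
  refine ⟨(List.nodup_append.1 h.1).1, fun S₁ e S₂ hS => h.2 S₁ e (S₂ ++ T) ?_⟩
  simp [hS]

theorem Sched.preceding_card_lt {M : ℕ} {U S₁ S₂ : List α} {e : α}
    (h : Sched M U (S₁ ++ e :: S₂)) : (preceding U e).card < M + S₁.length := by
  have h₁ := (h.2 S₁ e S₂ rfl).2
  have h₂ := Finset.le_card_sdiff S₁.toFinset (preceding U e)
  have h₃ := List.toFinset_card_le S₁
  omega

/-- An element that arrives before some element of a written sequence `S`, but is not in `S`,
is in the buffer when `S` has been written. -/
theorem Sched.card_preceding_sdiff_lt {M : ℕ} {U S : List α} (h : Sched M U S) {x e : α}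
    (he : e ∈ S) (hx : x ∈ preceding U e) : (preceding U x \ S.toFinset).card < M := by
  obtain ⟨S₁, S₂, rfl⟩ := List.append_of_mem he
  refine lt_of_le_of_lt (Finset.card_le_card ?_) (h.2 S₁ e S₂ rfl).2
  refine Finset.sdiff_subset_sdiff (preceding_subset hx) ?_
  intro z
  simp
  tauto

/-- Reading does not change `B ++ I`, and a written element is among its first `M` entries; free
slots only restrict the machine further. -/
theorem Produces.sched {M : ℕ} {B I S : List α} (h : Produces M B I S) (hB : B.length ≤ M)
    (hnd : (B ++ I).Nodup) : Sched M (B ++ I) S ∧ B ++ I ⊆ S := by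
  induction h with
  | done => exact ⟨Sched.nil _ _, by simp⟩
  | @read B I S x hlt _ ih =>
    simpa using ih (by simpa using hlt) (by simpa using hnd)
  | @write B I S e he _ ih =>
    have herase : (B ++ I).erase e = B.erase e ++ I := List.erase_append_left _ he
    obtain ⟨h₁, h₂⟩ := ih ((List.length_erase_le).trans hB) (by
      rw [← herase]; exact hnd.erase e)
    rw [← herase] at h₁ h₂
    refine ⟨h₁.cons hnd ?_, fun y hy => ?_⟩
    · rw [List.take_append]
      exact List.mem_append_left _ (by rwa [List.take_of_length_le hB])
    · by_cases hye : y = e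
      · simp [hye]
      · exact List.mem_cons_of_mem _ (h₂ ((List.mem_erase_of_ne hye).2 hy))

/-! ### Maximal runs -/

theorem maximalRunFrom_sched (M : ℕ) (d : Dir) (n : ℕ) (last : Option α) {U : List α}
    (hU : U.Nodup) : Sched M U (maximalRunFrom M d n last U) := by
  induction n generalizing last U with
  | zero => exact Sched.nil _ _
  | succ n ih =>
    rw [maximalRunFrom]
    cases h : d.next last (U.take M) with
    | none => exact Sched.nil _ _
    | some e => exact (ih (some e) (hU.erase e)).cons hU (Dir.next_eq_some h).1

theorem lt_of_mem_maximalRunFrom {M : ℕ} {d : Dir} {n : ℕ} {l : α} {U : List α} {x : α}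
    (hx : x ∈ maximalRunFrom M d n (some l) U) : d.lt l x := by
  induction n generalizing l U with
  | zero => simp [maximalRunFrom] at hx
  | succ n ih =>
    rw [maximalRunFrom] at hx
    cases h : d.next (some l) (U.take M) with
    | none => simp [h] at hx
    | some e =>
      have hle : d.lt l e := (Dir.next_eq_some h).2.1 l rfl
      rcases List.mem_cons.1 (by simpa [h] using hx) with rfl | hx
      · exact hle
      · exact Dir.lt_trans hle (ih hx)

theorem maximalRunFrom_pairwise (M : ℕ) (d : Dir) (n : ℕ) (last : Option α) (U : List α) :
    (maximalRunFrom M d n last U).Pairwise d.lt := by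
  induction n generalizing last U with
  | zero => exact List.Pairwise.nil
  | succ n ih =>
    rw [maximalRunFrom]
    cases h : d.next last (U.take M) with
    | none => exact List.Pairwise.nil
    | some e => exact List.Pairwise.cons (fun _ => lt_of_mem_maximalRunFrom) (ih _ _)

/-- A maximal run that does not write `x` passes `x` when `x` has not yet been read. -/
theorem le_card_of_not_mem_maximalRunFrom {M : ℕ} {d : Dir} {n : ℕ} {last : Option α}
    {U : List α} (hU : U.Nodup) (hn : U.length ≤ n) {x : α} (hx : x ∈ U)
    (hlast : ∀ l ∈ last, d.lt l x) (hx' : x ∉ maximalRunFrom M d n last U) :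
    M ≤ (preceding U x \ {y ∈ (maximalRunFrom M d n last U).toFinset | d.lt y x}).card := by
  induction n generalizing last U with
  | zero => simp_all
  | succ n ih =>
    rw [maximalRunFrom] at hx' ⊢
    cases h : d.next last (U.take M) with
    | none =>
      have := Dir.next_eq_none.1 h x
      simp only [mem_take_iff hU, hx, true_and] at this
      simp only [List.toFinset_nil, Finset.filter_empty, Finset.sdiff_empty]
      by_contra! hlt
      exact this hlt hlast
    | some e =>
      obtain ⟨heB, -, hmin⟩ := Dir.next_eq_some h
      simp only [h, List.mem_cons, not_or] at hx' ⊢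
      obtain ⟨hxe, hxL⟩ := hx'
      have heU := List.mem_of_mem_take heB
      -- If `e` lies beyond `x`, the run passes `x` now: nothing it writes from here on comes before
      -- `x`, and the choice of `e` shows that `x` is not in the buffer. Otherwise `e` comes before
      -- `x` and the induction continues.
      rcases d.lt_or_gt_of_ne hxe with hlt | hlt
      · have hempty : ({y ∈ (e :: maximalRunFrom M d n (some e) (U.erase e)).toFinset |
            d.lt y x} : Finset α) = ∅ := by
          rw [Finset.filter_eq_empty_iff]
          intro y hy hyx
          rcases List.mem_cons.1 (List.mem_toFinset.1 hy) with rfl | hy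
          · exact d.lt_irrefl _ (Dir.lt_trans hyx hlt)
          · exact d.lt_irrefl _ (Dir.lt_trans (Dir.lt_trans hyx hlt) (lt_of_mem_maximalRunFrom hy))
        rw [hempty, Finset.sdiff_empty]
        by_contra! hcard
        exact hmin x ((mem_take_iff hU).2 ⟨hx, hcard⟩) hlast hlt
      · have hlen := List.length_erase_of_mem heU
        refine (ih (hU.erase e) (by omega) ((List.mem_erase_of_ne hxe).2 hx)
          (by simpa using hlt) hxL).trans (Finset.card_le_card ?_)
        rw [hU.erase_eq_filter, preceding_filter (by simpa using hxe)]
        intro z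
        simp
        tauto

theorem maximalRun_sched (M : ℕ) (d : Dir) {U : List α} (hU : U.Nodup) :
    Sched M U (maximalRun M d U) :=
  maximalRunFrom_sched M d _ _ hU

theorem maximalRun_pairwise (M : ℕ) (d : Dir) (U : List α) :
    (maximalRun M d U).Pairwise d.lt :=
  maximalRunFrom_pairwise M d _ _ U

/-- Once the run has written `W`, all of it before `x`, the element `x` has entered the buffer, so
the run cannot pass it. -/
theorem mem_maximalRun_of_card_lt {M : ℕ} {d : Dir} {U : List α} (hU : U.Nodup) {x : α}
    (hx : x ∈ U) {W : Finset α} (hW : ∀ y ∈ W, y ∈ maximalRun M d U ∧ d.lt y x)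
    (hcard : (preceding U x \ W).card < M) : x ∈ maximalRun M d U := by
  by_contra hx'
  have h := le_card_of_not_mem_maximalRunFrom hU le_rfl hx (by simp) hx'
  refine absurd (h.trans (Finset.card_le_card (Finset.sdiff_subset_sdiff le_rfl ?_)))
    (not_le.2 hcard)
  intro y hy
  exact Finset.mem_filter.2 ⟨List.mem_toFinset.2 (hW y hy).1, (hW y hy).2⟩

theorem afterRun_eq_filter (M : ℕ) (d : Dir) {U : List α} (hU : U.Nodup) :
    afterRun M d U = U.filter (· ∉ maximalRun M d U) := by
  rw [afterRun, hU.sdiff_eq_filter]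

theorem preceding_afterRun {M : ℕ} {d : Dir} {U : List α} (hU : U.Nodup) {x : α}
    (hx : x ∉ maximalRun M d U) :
    preceding (afterRun M d U) x = preceding U x \ (maximalRun M d U).toFinset := by
  rw [afterRun_eq_filter M d hU, preceding_filter (by simpa using hx)]
  ext z
  simp

/-! ### Maximal runs cover the runs of any machine -/

theorem Pairwise.prefix_lt {d : Dir} {S₁ S₂ : List α} {e y : α}
    (h : (S₁ ++ e :: S₂).Pairwise d.lt) (hy : y ∈ S₁) : d.lt y e :=
  (List.pairwise_append.1 h).2.2 y hy e (by simp)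

/-- Induction along the elements of a list. -/
theorem forall_mem_of_split {β : Type*} {S : List β} {Q : β → Prop}
    (h : ∀ S₁ e S₂, S = S₁ ++ e :: S₂ → (∀ y ∈ S₁, Q y) → Q e) : ∀ e ∈ S, Q e := by
  suffices H : ∀ T S₂, S = T ++ S₂ → ∀ y ∈ T, Q y from H S [] (by simp)
  intro T
  induction T using List.reverseRecOn with
  | nil => simp
  | append_singleton T e ih =>
    intro S₂ hS y hy
    have hT := ih (e :: S₂) (by simpa using hS)
    rcases List.mem_append.1 hy with hy | hy
    · exact hT y hy
    · obtain rfl := List.mem_singleton.1 hy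
      exact h T y S₂ (by simpa using hS) hT

theorem Sched.subset_maximalRun {M : ℕ} {d : Dir} {U q : List α} (hU : U.Nodup)
    (h : Sched M U q) (hq : q.Pairwise d.lt) : q ⊆ maximalRun M d U := by
  refine forall_mem_of_split fun S₁ e S₂ hS hS₁ => ?_
  obtain ⟨h₁, h₂⟩ := h.2 S₁ e S₂ hS
  refine mem_maximalRun_of_card_lt hU h₁ (fun y hy => ?_) h₂
  rw [List.mem_toFinset] at hy
  exact ⟨hS₁ y hy, Pairwise.prefix_lt (hS ▸ hq) hy⟩

/-- Two maximal runs in one direction, the first of them greedy, cover a maximal run in the other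
direction. -/
theorem mem_two_runs_of_mem_opp {M : ℕ} {d : Dir} {U : List α} (hU : U.Nodup)
    (hlen : (maximalRun M d.opp U).length ≤ (maximalRun M d U).length) {x : α}
    (hx : x ∈ maximalRun M d.opp U) (hxr : x ∉ maximalRun M d U) :
    x ∈ maximalRun M d (afterRun M d U) := by
  have hr := maximalRun_sched M d hU
  have hp := maximalRun_sched M d.opp hU
  have hxU : x ∈ U := hp.subset hx
  have hV : (afterRun M d U).Nodup := by
    rw [afterRun_eq_filter M d hU]; exact hU.filter _
  refine mem_maximalRun_of_card_lt (W := ∅) hV ?_ (by simp) ?_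
  · rw [afterRun_eq_filter M d hU]
    simpa using ⟨hxU, hxr⟩
  rw [preceding_afterRun hU hxr, Finset.sdiff_empty]
  -- It suffices that `x` is in the buffer after the greedy run. If the whole greedy run arrives
  -- before `x`, it removes at least as many predecessors of `x` as the opposite run could before
  -- writing `x`. If it writes some `e` arriving after `x`, then `x` was already in the buffer.
  by_cases hsub : (maximalRun M d U).toFinset ⊆ preceding U x
  · rw [Finset.card_sdiff_of_subset hsub, List.toFinset_card_of_nodup hr.1]
    obtain ⟨p₁, p₂, hp₁₂⟩ := List.append_of_mem hx
    have h₁ := Sched.preceding_card_lt (hp₁₂ ▸ hp)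
    -- Only `0 < M` is needed from this, for the case where the truncated subtraction is zero.
    have h₃ := (hp.2 p₁ x p₂ hp₁₂).2
    have h₂ := congrArg List.length hp₁₂
    simp only [List.length_append, List.length_cons] at h₂
    omega
  · obtain ⟨e, he, hex⟩ := Finset.not_subset.1 hsub
    rw [List.mem_toFinset] at he
    refine hr.card_preceding_sdiff_lt he ?_
    have hne : x ≠ e := fun h => hxr (h ▸ he)
    exact (preceding_total hxU hne).resolve_right hex

/-- Two maximal runs in one direction, the first of them greedy, cover any run in that direction
that a machine writes after a maximal run in the other direction. -/
theorem mem_two_runs_of_opp_then_same {M : ℕ} {d : Dir} {U q : List α} (hU : U.Nodup)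
    (hlen : (maximalRun M d.opp U).length ≤ (maximalRun M d U).length)
    (hq : Sched M (afterRun M d.opp U) q) (hqd : q.Pairwise d.lt) :
    ∀ x ∈ q, x ∈ maximalRun M d U ∨ x ∈ maximalRun M d (afterRun M d U) := by
  have hr := maximalRun_sched M d hU
  have hp := maximalRun_sched M d.opp hU
  have hV : (afterRun M d U).Nodup := by
    rw [afterRun_eq_filter M d hU]; exact hU.filter _
  have hrd := maximalRun_pairwise M d U
  have hpd := maximalRun_pairwise M d.opp U
  -- Take `x` to be the first element of `q` missed by both runs, so that `q₁` is covered.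
  refine forall_mem_of_split fun q₁ x q₂ hS hq₁ => ?_
  by_contra! hx
  obtain ⟨hxr, hxs⟩ := hx
  have hqU : ∀ y ∈ q, y ∈ U ∧ y ∉ maximalRun M d.opp U := by
    intro y hy
    have := hq.subset hy
    rw [afterRun_eq_filter M d.opp hU] at this
    simpa using this
  have hxq : x ∈ q := by simp [hS]
  obtain ⟨hxU, hxp⟩ := hqU x hxq
  have hxV : x ∈ afterRun M d U := by
    rw [afterRun_eq_filter M d hU]
    simpa using ⟨hxU, hxr⟩
  have hq₁x : ∀ y ∈ q₁, d.lt y x := fun y hy => Pairwise.prefix_lt (hS ▸ hqd) hy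
  have hcq := (hq.2 q₁ x q₂ hS).2
  rw [preceding_afterRun hU hxp] at hcq
  have hcs := le_card_of_not_mem_maximalRunFrom hV le_rfl hxV (by simp) hxs
  rw [preceding_afterRun hU hxr] at hcs
  change M ≤ (_ \ {y ∈ (maximalRun M d (afterRun M d U)).toFinset | d.lt y x}).card at hcs
  set r := maximalRun M d U with hr_def
  set p := maximalRun M d.opp U with hp_def
  set s := maximalRun M d (afterRun M d U) with hs_def
  have hq₁sub : ∀ y ∈ q₁, y ∈ r ∨ (y ∈ s ∧ d.lt y x) := fun y hy =>
    (hq₁ y hy).imp_right fun h => ⟨h, hq₁x y hy⟩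
  -- Without such a `z`, all elements of `p` and `q₁` outside `r` are written by `s` before `x`;
  -- then the set counted in `hcs` lies inside the one counted in `hcq`, which is too small.
  obtain ⟨z, hzp, hzr, hxz⟩ : ∃ z ∈ p, z ∉ r ∧ d.lt x z := by
    by_contra! hz
    refine absurd (lt_of_le_of_lt hcs (lt_of_le_of_lt (Finset.card_le_card ?_) hcq)) (lt_irrefl _)
    intro y
    simp only [Finset.mem_sdiff, List.mem_toFinset, Finset.mem_filter, not_and]
    rintro ⟨⟨hy, hyr⟩, hys⟩
    refine ⟨⟨hy, fun hyp => ?_⟩, fun hyq => ?_⟩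
    · have hs := mem_two_runs_of_mem_opp hU hlen hyp hyr
      have hne : y ≠ x := by
        rintro rfl
        exact hxs hs
      exact (d.lt_or_gt_of_ne hne).elim (hys hs) (hz y hyp hyr)
    · rcases hq₁sub y hyq with h | h
      · exact hyr h
      · exact hys h.1 h.2
  -- Had `r` written something that arrives after `x`, then `x` would be in the buffer when `s`
  -- starts.
  have hrN : r.toFinset ⊆ preceding U x := by
    intro e he
    rw [List.mem_toFinset] at he
    by_contra hex
    have hne : x ≠ e := fun h => hxr (h ▸ he)
    have := hr.card_preceding_sdiff_lt he ((preceding_total hxU hne).resolve_right hex)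
    exact hxs (mem_maximalRun_of_card_lt (W := ∅) hV hxV (by simp)
      (by rwa [preceding_afterRun hU hxr, Finset.sdiff_empty]))
  -- Such a `w` comes before `z` in direction `d`. If `w` arrives first, it is in the buffer when
  -- `p` writes `z`, so `p` goes on to write `w`; if `z` arrives first, `r` writes `z` after `w`.
  -- Both are excluded.
  have hdisj : ∀ w ∈ q₁, w ∉ r := by
    intro w hw hwr
    have hwp : w ∉ p := (hqU w (by simp [hS, hw])).2
    have hwU : w ∈ U := hr.subset hwr
    have hzU : z ∈ U := hp.subset hzp
    have hwz : d.lt w z := Dir.lt_trans (hq₁x w hw) hxz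
    have hne : w ≠ z := by
      rintro rfl
      exact hwp hzp
    rcases preceding_total hwU hne with h | h
    · obtain ⟨p₁, p₂, hp₁₂⟩ := List.append_of_mem hzp
      refine hwp (mem_maximalRun_of_card_lt (W := p₁.toFinset) hU hwU (fun y hy => ?_)
        (lt_of_le_of_lt (Finset.card_le_card (Finset.sdiff_subset_sdiff (preceding_subset h) le_rfl))
          (hp.2 p₁ z p₂ hp₁₂).2))
      rw [List.mem_toFinset] at hy
      refine ⟨by rw [← hp_def, hp₁₂]; simp [hy], ?_⟩
      have := Pairwise.prefix_lt (hp₁₂ ▸ hpd) hy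
      exact Dir.lt_trans this (Dir.opp_lt.2 hwz)
    · obtain ⟨r₁, r₂, hr₁₂⟩ := List.append_of_mem hwr
      refine hzr (mem_maximalRun_of_card_lt (W := r₁.toFinset) hU hzU (fun y hy => ?_)
        (lt_of_le_of_lt (Finset.card_le_card (Finset.sdiff_subset_sdiff (preceding_subset h) le_rfl))
          (hr.2 r₁ w r₂ hr₁₂).2))
      rw [List.mem_toFinset] at hy
      refine ⟨by rw [← hr_def, hr₁₂]; simp [hy], ?_⟩
      have := Pairwise.prefix_lt (hr₁₂ ▸ hrd) hy
      exact Dir.lt_trans this hwz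
  set N := preceding U x with hN
  set Q := q₁.toFinset ∩ N with hQ
  have hrQ : Disjoint r.toFinset Q := by
    rw [Finset.disjoint_left]
    intro y hy hyQ
    simp only [hQ, Finset.mem_inter, List.mem_toFinset] at hy hyQ
    exact hdisj y hyQ.1 hy
  -- Since `r` and `Q` are disjoint parts of `N`, removing them leaves `N.card - r.length - Q.card`
  -- elements. Removing `p` and `Q` leaves at least as many, because `p` is no longer than `r`, yet
  -- `h₂` says fewer than `M`.
  have h₁ : M ≤ (N \ (r.toFinset ∪ Q)).card := by
    refine hcs.trans (Finset.card_le_card ?_)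
    intro y
    simp only [hQ, Finset.mem_sdiff, List.mem_toFinset, Finset.mem_filter, Finset.mem_union,
      Finset.mem_inter, not_and, not_or]
    rintro ⟨⟨hy, hyr⟩, hys⟩
    refine ⟨hy, hyr, fun hyq _ => ?_⟩
    rcases hq₁sub y hyq with h | h
    · exact hyr h
    · exact hys h.1 h.2
  have h₂ : (N \ (p.toFinset ∪ Q)).card < M := by
    refine lt_of_le_of_lt (Finset.card_le_card ?_) hcq
    intro y
    simp only [hQ, Finset.mem_sdiff, List.mem_toFinset, Finset.mem_union, Finset.mem_inter]
    tauto
  have hsub : r.toFinset ∪ Q ⊆ N := Finset.union_subset hrN Finset.inter_subset_right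
  have h₃ := Finset.card_le_card hsub
  rw [Finset.card_sdiff_of_subset hsub] at h₁
  rw [Finset.card_union_of_disjoint hrQ, List.toFinset_card_of_nodup hr.1] at h₁ h₃
  have h₄ := Finset.le_card_sdiff (p.toFinset ∪ Q) N
  have h₅ := Finset.card_union_le p.toFinset Q
  have h₆ := List.toFinset_card_le p
  omega

theorem IsRun.exists_dir {q : List α} (h : IsRun q) (hnd : q.Nodup) :
    ∃ d : Dir, q.Pairwise d.lt := by
  rcases h with h | h
  · exact ⟨.up, (h.and hnd).imp fun hab => lt_of_le_of_ne hab.1 hab.2⟩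
  · exact ⟨.down, (h.and hnd).imp fun hab => lt_of_le_of_ne hab.1 hab.2.symm⟩

theorem Dir.isRun_of_pairwise {d : Dir} {q : List α} (h : q.Pairwise d.lt) : IsRun q := by
  cases d
  · exact Or.inl (h.imp fun hab => le_of_lt hab)
  · exact Or.inr (h.imp fun hab => le_of_lt hab)

theorem IsRun.filter {q : List α} (h : IsRun q) (p : α → Bool) : IsRun (q.filter p) :=
  h.imp (fun h => h.filter p) (fun h => h.filter p)

/-! ### Three runs of a round cover two runs of any machine -/

/-- With `q₁` filtered away, what is left of `q₂` is a run that can start at once from the filtered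
sequence. -/
theorem Sched.mem_maximalRun_of_append {M : ℕ} {d : Dir} {U q₁ q₂ : List α} (hU : U.Nodup)
    (h : Sched M U (q₁ ++ q₂)) {p : α → Bool} (hq₁ : ∀ y ∈ q₁, ¬ p y) (hq₂ : q₂.Pairwise d.lt)
    {x : α} (hx : x ∈ q₂) (hpx : p x) : x ∈ maximalRun M d (U.filter p) := by
  have h' := h.filter p
  rw [List.filter_append, List.filter_eq_nil_iff.2 hq₁, List.nil_append] at h'
  exact h'.subset_maximalRun (hU.filter p) (hq₂.filter p) (List.mem_filter.2 ⟨hx, hpx⟩)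

theorem Sched.mem_three_runs {M : ℕ} {d : Dir} {U q₁ q₂ : List α} (hU : U.Nodup)
    (hlen : (maximalRun M d.opp U).length ≤ (maximalRun M d U).length)
    (h : Sched M U (q₁ ++ q₂)) (hq₁ : IsRun q₁) (hq₂ : IsRun q₂) :
    ∀ x ∈ q₁ ++ q₂, x ∈ maximalRun M d U ∨ x ∈ maximalRun M d (afterRun M d U) ∨
      x ∈ maximalRun M d.opp (afterRun M d (afterRun M d U)) := by
  obtain ⟨d₁, hd₁⟩ := hq₁.exists_dir (List.nodup_append.1 h.1).1
  obtain ⟨d₂, hd₂⟩ := hq₂.exists_dir (List.nodup_append.1 h.1).2.1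
  have dir_cases : ∀ d' : Dir, d' = d ∨ d' = d.opp := by
    intro d'
    cases d <;> cases d' <;> simp [Dir.opp]
  have hV : (afterRun M d U).Nodup := by
    rw [afterRun_eq_filter M d hU]; exact hU.filter _
  have hfirst : ∀ x ∈ q₁, x ∈ maximalRun M d U ∨ x ∈ maximalRun M d (afterRun M d U) := by
    intro x hx
    have hx' := h.append_left.subset_maximalRun hU hd₁ hx
    rcases dir_cases d₁ with rfl | rfl
    · exact Or.inl hx'
    · by_cases hxr : x ∈ maximalRun M d U
      · exact Or.inl hxr
      · exact Or.inr (mem_two_runs_of_mem_opp hU hlen hx' hxr)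
  have hUs : afterRun M d (afterRun M d U) =
      U.filter fun y => y ∉ maximalRun M d U ∧ y ∉ maximalRun M d (afterRun M d U) := by
    rw [afterRun_eq_filter M d hV]
    conv_lhs => enter [2]; rw [afterRun_eq_filter M d hU]
    rw [List.filter_filter]
    refine List.filter_congr fun y _ => ?_
    rw [Bool.decide_and, Bool.and_comm]
  intro x hx
  rcases List.mem_append.1 hx with hx | hx
  · exact (hfirst x hx).imp_right Or.inl
  by_cases hxr : x ∈ maximalRun M d U
  · exact Or.inl hxr
  by_cases hxs : x ∈ maximalRun M d (afterRun M d U)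
  · exact Or.inr (Or.inl hxs)
  refine Or.inr (Or.inr ?_)
  rcases dir_cases d₂ with rfl | rfl
  · exfalso
    rcases dir_cases d₁ with rfl | rfl
    · apply hxs
      rw [afterRun_eq_filter M d₁ hU]
      exact h.mem_maximalRun_of_append hU
        (fun y hy => by simpa using h.append_left.subset_maximalRun hU hd₁ hy) hd₂ hx
        (by simpa using hxr)
    · have hsub := h.append_left.subset_maximalRun hU hd₁
      have hsched := h.filter (· ∉ maximalRun M d₂.opp U)
      rw [List.filter_append, List.filter_eq_nil_iff (l := q₁).2
          (fun y hy => by simpa using hsub hy), List.nil_append,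
        ← afterRun_eq_filter M d₂.opp hU] at hsched
      by_cases hxp : x ∈ maximalRun M d₂.opp U
      · exact hxs (mem_two_runs_of_mem_opp hU hlen hxp hxr)
      · exact (mem_two_runs_of_opp_then_same hU hlen hsched (hd₂.filter _) x
          (List.mem_filter.2 ⟨hx, by simpa using hxp⟩)).elim hxr hxs
  · rw [hUs]
    refine h.mem_maximalRun_of_append hU (fun y hy => ?_) hd₂ hx (by simpa using ⟨hxr, hxs⟩)
    have := hfirst y hy
    simp only [decide_eq_true_eq]
    tauto

/-! ### The number of runs -/

theorem numRuns_flatten_le {P : List (List α)} (hP : ∀ r ∈ P, IsRun r) :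
    numRuns P.flatten ≤ P.length :=
  Nat.sInf_le ⟨P, rfl, rfl, hP⟩

theorem exists_runs (S : List α) :
    ∃ P : List (List α), P.length = numRuns S ∧ P.flatten = S ∧ ∀ r ∈ P, IsRun r := by
  refine Nat.sInf_mem (s := {k : ℕ | ∃ P : List (List α), P.length = k ∧ P.flatten = S ∧
    ∀ r ∈ P, IsRun r}) ⟨_, S.map fun x => [x], rfl, ?_, ?_⟩
  · induction S with
    | nil => rfl
    | cons a S ih => simp [ih]
  · intro r hr
    obtain ⟨x, -, rfl⟩ := List.mem_map.1 hr
    exact Or.inl (List.pairwise_singleton _ _)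

theorem numRuns_nil : numRuns ([] : List α) = 0 :=
  Nat.le_zero.1 (numRuns_flatten_le (P := []) (by simp))

theorem IsRun.numRuns_append_le {q : List α} (hq : IsRun q) (S : List α) :
    numRuns (q ++ S) ≤ numRuns S + 1 := by
  obtain ⟨P, hlen, hflat, hP⟩ := exists_runs S
  have := numRuns_flatten_le (P := q :: P) (by simpa using ⟨hq, hP⟩)
  simpa [hlen, hflat] using this

theorem GreedyTriples.two_mul_numRuns_le {M : ℕ} {U T : List α} (h : GreedyTriples M U T)
    (hU : U.Nodup) {P : List (List α)} (hP : ∀ q ∈ P, IsRun q) (hS : Sched M U P.flatten)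
    (hsub : U ⊆ P.flatten) : 2 * numRuns T ≤ 3 * P.length := by
  induction h generalizing P with
  | done => simp [numRuns_nil]
  | @round U T d hne hlen hT ih =>
    have hrun : ∀ (d : Dir) (U : List α), IsRun (maximalRun M d U) := fun d U =>
      Dir.isRun_of_pairwise (maximalRun_pairwise M d U)
    have hV : (afterRun M d U).Nodup := by
      rw [afterRun_eq_filter M d hU]; exact hU.filter _
    have hV₂ : (afterRun M d (afterRun M d U)).Nodup := by
      rw [afterRun_eq_filter M d hV]; exact hV.filter _
    match P with
    | [] => exact absurd (List.subset_nil.1 (by simpa using hsub)) hne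
    | [q] =>
      simp only [List.flatten_cons, List.flatten_nil, List.append_nil] at hS hsub
      obtain ⟨d', hd'⟩ := (hP q (by simp)).exists_dir hS.1
      have hUr : ∀ d', U.length ≤ (maximalRun M d' U).length → afterRun M d' U = [] := by
        intro d' hl
        have hperm := ((maximalRun_sched M d' hU).1.subperm
          (maximalRun_sched M d' hU).subset).perm_of_length_le hl
        rw [afterRun_eq_filter M d' hU, List.filter_eq_nil_iff]
        intro y hy
        simpa using hperm.symm.subset hy
      -- One run exhausts `U`, so the maximal run in its direction does, and hence so does the
      -- greedy run, which is at least as long.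
      have hl : U.length ≤ (maximalRun M d U).length := by
        have h' : U.length ≤ (maximalRun M d' U).length :=
          (hU.subperm (List.Subset.trans hsub (hS.subset_maximalRun hU hd'))).length_le
        have : d' = d ∨ d' = d.opp := by
          cases d <;> cases d' <;> simp [Dir.opp]
        rcases this with rfl | rfl
        · exact h'
        · exact h'.trans hlen
      have hnil : ∀ d', maximalRun M d' ([] : List α) = [] := fun _ => rfl
      have hnil' : ∀ d', afterRun M d' ([] : List α) = [] := fun _ => rfl
      rw [hUr d hl, hnil', hnil'] at hT
      have hTnil : T = [] := by
        cases hT with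
        | done => rfl
        | round _ hne' => exact absurd rfl hne'
      rw [hUr d hl, hnil', hnil, hnil, hTnil]
      have h₁ := (hrun d U).numRuns_append_le []
      rw [numRuns_nil] at h₁
      simp only [List.append_nil, List.length_singleton] at h₁ ⊢
      omega
    | q₁ :: q₂ :: P =>
      have hS' : Sched M U ((q₁ ++ q₂) ++ P.flatten) := by simpa using hS
      have hcov := hS'.append_left.mem_three_runs hU hlen (hP q₁ (by simp)) (hP q₂ (by simp))
      let p : α → Bool := fun y => y ∉ maximalRun M d U ∧ y ∉ maximalRun M d (afterRun M d U) ∧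
        y ∉ maximalRun M d.opp (afterRun M d (afterRun M d U))
      have hU₃ : afterRun M d.opp (afterRun M d (afterRun M d U)) = U.filter p := by
        rw [afterRun_eq_filter M d.opp hV₂]
        conv_lhs => enter [2]; rw [afterRun_eq_filter M d hV]
        conv_lhs => enter [2, 2]; rw [afterRun_eq_filter M d hU]
        rw [List.filter_filter, List.filter_filter]
        refine List.filter_congr fun y _ => ?_
        simp only [p, Bool.decide_and]
        cases decide (y ∉ maximalRun M d U) <;>
          cases decide (y ∉ maximalRun M d (afterRun M d U)) <;> simp
      have hq : (q₁ ++ q₂).filter p = [] := by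
        rw [List.filter_eq_nil_iff]
        intro y hy
        have := hcov y hy
        simp only [p, decide_eq_true_eq]
        tauto
      have hSp := hS'.filter p
      rw [List.filter_append, hq, List.nil_append, List.filter_flatten] at hSp
      have hle := ih (P := P.map (List.filter p)) (hU₃ ▸ hU.filter p) (fun q hqm => by
          obtain ⟨q', hq', rfl⟩ := List.mem_map.1 hqm
          exact (hP q' (by simp [hq'])).filter p)
        (hU₃ ▸ hSp) (fun y hy => by
          rw [hU₃, List.mem_filter] at hy
          rw [← List.filter_flatten, List.mem_filter]
          refine ⟨?_, hy.2⟩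
          have hy' : y ∈ (q₁ ++ q₂) ++ P.flatten := by simpa using hsub hy.1
          refine (List.mem_append.1 hy').resolve_left fun h => ?_
          exact List.filter_eq_nil_iff.1 hq y h hy.2)
      rw [List.append_assoc, List.append_assoc]
      have h₁ := (hrun d U).numRuns_append_le (maximalRun M d (afterRun M d U) ++
        (maximalRun M d.opp (afterRun M d (afterRun M d U)) ++ T))
      have h₂ := (hrun d (afterRun M d U)).numRuns_append_le
        (maximalRun M d.opp (afterRun M d (afterRun M d U)) ++ T)
      have h₃ := (hrun d.opp (afterRun M d (afterRun M d U))).numRuns_append_le T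
      simp only [List.length_map, List.length_cons] at hle ⊢
      omega

theorem GreedyTriples.numRuns_le {M : ℕ} {I T : List α} (h : GreedyTriples M I T)
    (hI : I.Nodup) (hT : Produces M [] I T) :
    (numRuns T : ℝ) ≤ 3 / 2 * (opt M I : ℝ) := by
  -- `T` itself shows that the infimum is over a nonempty set and is therefore attained.
  obtain ⟨S, hS, hopt⟩ : ∃ S, Produces M [] I S ∧ numRuns S = opt M I :=
    Nat.sInf_mem (s := {k : ℕ | ∃ S : List α, Produces M [] I S ∧ numRuns S = k}) ⟨_, T, hT, rfl⟩
  obtain ⟨P, hlen, rfl, hP⟩ := exists_runs S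
  obtain ⟨h₁, h₂⟩ := hS.sched (by simp) (by simpa using hI)
  have h₃ : 2 * numRuns T ≤ 3 * P.length := h.two_mul_numRuns_le hI hP h₁ h₂
  rw [hlen, hopt] at h₃
  have h₄ : (2 * numRuns T : ℝ) ≤ 3 * opt M I := by exact_mod_cast h₃
  linarith

/-! ### The greedy direction can be seen in a window of `4 * M` elements -/

theorem Sched.mem_take {M K j : ℕ} {U S : List α} (hU : U.Nodup) (h : Sched M U S)
    (hj : j < S.length) (hK : M + j ≤ K) : S[j] ∈ U.take K := by
  have hS : S = S.take j ++ S[j] :: S.drop (j + 1) := by simp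
  refine (mem_take_iff hU).2 ⟨h.subset (List.getElem_mem hj), ?_⟩
  have h₁ := Sched.preceding_card_lt (hS ▸ h)
  rw [List.length_take] at h₁
  omega

theorem Sched.card_toFinset_take {M k : ℕ} {U S : List α} (h : Sched M U S)
    (hk : k ≤ S.length) : (S.take k).toFinset.card = k := by
  rw [List.toFinset_card_of_nodup (h.1.sublist (List.take_sublist _ _)), List.length_take]
  omega

theorem Sched.take_toFinset_subset {M k K : ℕ} {U S : List α} (hU : U.Nodup) (h : Sched M U S)
    (hk : M + k ≤ K + 1) : (S.take k).toFinset ⊆ (U.take K).toFinset := by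
  intro y hy
  rw [List.mem_toFinset] at hy ⊢
  obtain ⟨j, hj, rfl⟩ := List.mem_take_iff_getElem.1 hy
  exact h.mem_take hU _ (by omega)

/-- Two runs in opposite directions that start from the same buffer cannot both be long. -/
theorem min_length_lt_of_opp {M : ℕ} (hM : 0 < M) {d : Dir} {U r p : List α} (hU : U.Nodup)
    (hlen : 4 * M ≤ U.length + 1) (hr : Sched M U r) (hp : Sched M U p)
    (hrd : r.Pairwise d.lt) (hpd : p.Pairwise d.opp.lt) :
    r.length < 3 * M ∨ p.length < 3 * M := by
  by_contra! hlong
  obtain ⟨hrl, hpl⟩ := hlong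
  have hcard : ∀ K, K ≤ U.length → (U.take K).toFinset.card = K := fun K hK => by
    rw [List.toFinset_card_of_nodup (hU.sublist (List.take_sublist _ _)), List.length_take]
    omega
  set T := (U.take (4 * M - 1)).toFinset with hT
  have hTc : T.card = 4 * M - 1 := hcard _ (by omega)
  have hr' : (r.take (3 * M)).toFinset ⊆ T := hr.take_toFinset_subset hU (by omega)
  have hp' : (p.take (3 * M)).toFinset ⊆ T := hp.take_toFinset_subset hU (by omega)
  -- Each run's first `3 * M` elements miss only `M - 1` elements of `T`. But each of the last `2 *
  -- M - 1` elements of `T` is missed by at least one of the two, and `2 * M - 1 > 2 * (M - 1)`.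
  have hsub : T \ (U.take (2 * M)).toFinset ⊆
      (T \ (r.take (3 * M)).toFinset) ∪ (T \ (p.take (3 * M)).toFinset) := by
    intro y hy
    rw [Finset.mem_sdiff, hT, List.mem_toFinset, List.mem_toFinset, mem_take_iff hU,
      mem_take_iff hU] at hy
    obtain ⟨⟨hyU, hy₁⟩, hy₂⟩ := hy
    have hy₂ : 2 * M ≤ (preceding U y).card := by
      by_contra! hlt
      exact hy₂ ⟨hyU, hlt⟩
    -- Here `k ≥ M`. If both runs wrote `y`, each would do so after its entry of index `k`, so their
    -- first `k + 1` entries would lie on different sides of `y`: `2 * (k + 1)` distinct elements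
    -- among the first `M + k` of `U`, which is impossible.
    obtain ⟨k, hk⟩ : ∃ k, (preceding U y).card = M + k := Nat.exists_eq_add_of_le (by omega)
    have key : ∀ (d : Dir) (S : List α), Sched M U S → S.Pairwise d.lt → (hl : 3 * M ≤ S.length) →
        y ∈ S.take (3 * M) → d.lt (S[k]'(by omega)) y := by
      intro d S hS hSd hl hyS
      obtain ⟨j, hj, rfl⟩ := List.mem_take_iff_getElem.1 hyS
      have h₁ := ((mem_take_iff hU).1 (hS.mem_take (j := j) (K := M + j) hU (by omega) le_rfl)).2
      exact List.pairwise_iff_getElem.1 hSd _ _ _ _ (by omega)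
    by_contra hnot
    simp only [Finset.mem_union, Finset.mem_sdiff, List.mem_toFinset, not_or, not_and, not_not]
      at hnot
    have hyT : y ∈ T := by
      rw [hT, List.mem_toFinset, mem_take_iff hU]
      exact ⟨hyU, hy₁⟩
    have hlt := Dir.lt_trans (key d r hr hrd hrl (hnot.1 hyT))
      (Dir.opp_lt.1 (key d.opp p hp hpd hpl (hnot.2 hyT)))
    have hmono : ∀ (d : Dir) (S : List α), S.Pairwise d.lt → (hl : 3 * M ≤ S.length) →
        ∀ x ∈ S.take (k + 1), x = S[k]'(by omega) ∨ d.lt x (S[k]'(by omega)) := by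
      intro d S hSd hl x hx
      obtain ⟨j, hj, rfl⟩ := List.mem_take_iff_getElem.1 hx
      rcases Nat.lt_or_ge j k with h | h
      · exact Or.inr (List.pairwise_iff_getElem.1 hSd _ _ _ _ h)
      · obtain rfl : j = k := by omega
        exact Or.inl rfl
    have hdisj : Disjoint (r.take (k + 1)).toFinset (p.take (k + 1)).toFinset := by
      rw [Finset.disjoint_left]
      intro x hxr hxp
      rw [List.mem_toFinset] at hxr hxp
      have h₁ : d.lt x p[k] := by
        rcases hmono d r hrd hrl x hxr with h | h
        · exact h ▸ hlt
        · exact Dir.lt_trans h hlt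
      rcases hmono d.opp p hpd hpl x hxp with h | h
      · exact d.lt_irrefl _ (h ▸ h₁)
      · exact d.lt_irrefl _ (Dir.lt_trans h₁ (Dir.opp_lt.1 h))
    have h₁ := Finset.card_le_card (Finset.union_subset
      (hr.take_toFinset_subset (k := k + 1) (K := M + k) hU (by omega))
      (hp.take_toFinset_subset (k := k + 1) (K := M + k) hU (by omega)))
    rw [Finset.card_union_of_disjoint hdisj, hr.card_toFinset_take (by omega),
      hp.card_toFinset_take (by omega), hcard _ (by omega)] at h₁
    omega
  have h₁ := (Finset.card_le_card hsub).trans (Finset.card_union_le _ _)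
  have h₂ := Finset.le_card_sdiff (U.take (2 * M)).toFinset T
  rw [Finset.card_sdiff_of_subset hr', Finset.card_sdiff_of_subset hp',
    hr.card_toFinset_take hrl, hp.card_toFinset_take hpl, hTc] at h₁
  rw [hTc, hcard _ (by omega)] at h₂
  omega

theorem maximalRunFrom_take_fuel (M : ℕ) (d : Dir) {k n : ℕ} (hk : k ≤ n) (last : Option α)
    (U : List α) : (maximalRunFrom M d n last U).take k = maximalRunFrom M d k last U := by
  induction k generalizing n last U with
  | zero => simp [maximalRunFrom]
  | succ k ih =>
    obtain ⟨n, rfl⟩ : ∃ m, n = m + 1 := ⟨n - 1, by omega⟩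
    rw [maximalRunFrom, maximalRunFrom]
    cases d.next last (U.take M) with
    | none => rfl
    | some e => simp [ih (Nat.le_of_succ_le_succ hk)]

theorem erase_take_of_mem {V M : ℕ} {U : List α} {e : α} (hMV : M ≤ V) (he : e ∈ U.take M) :
    (U.take V).erase e = (U.erase e).take (V - 1) := by
  induction U generalizing V M with
  | nil => simp
  | cons a U ih =>
    cases M with
    | zero => simp at he
    | succ M =>
      obtain ⟨V, rfl⟩ : ∃ m, V = m + 1 := ⟨V - 1, by omega⟩
      by_cases hae : a = e
      · subst hae
        simp
      · have he' : e ∈ U.take M := by simpa [Ne.symm hae] using he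
        have hV : V ≠ 0 := by
          rintro rfl
          obtain rfl : M = 0 := by omega
          simp at he'
        obtain ⟨V, rfl⟩ := Nat.exists_eq_succ_of_ne_zero hV
        have := ih (V := V + 1) (by omega) he'
        simp [hae, this]

/-- Each write brings one new element into the buffer, and the last of `k` choices is made after `k
- 1` writes; so `M + k - 1` elements suffice. -/
theorem maximalRunFrom_take (M : ℕ) (d : Dir) {k V : ℕ} (hV : M + k ≤ V + 1) (last : Option α)
    (U : List α) : maximalRunFrom M d k last (U.take V) = maximalRunFrom M d k last U := by
  induction k generalizing V last U with
  | zero => rfl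
  | succ k ih =>
    rw [maximalRunFrom, maximalRunFrom, List.take_take, min_eq_left (by omega)]
    cases h : d.next last (U.take M) with
    | none => rfl
    | some e =>
      simp only
      rw [erase_take_of_mem (by omega) (Dir.next_eq_some h).1, ih (by omega)]

theorem min_length_maximalRun_take (M : ℕ) (d : Dir) {U : List α} (hU : 4 * M ≤ U.length) :
    min (3 * M) (maximalRun M d (U.take (4 * M))).length =
      min (3 * M) (maximalRun M d U).length := by
  rw [← List.length_take, ← List.length_take, maximalRun, maximalRun,
    maximalRunFrom_take_fuel M d (by rw [List.length_take]; omega),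
    maximalRunFrom_take_fuel M d (by omega), maximalRunFrom_take M d (by omega)]

theorem length_le_of_length_take_le {M : ℕ} (hM : 0 < M) {d : Dir} {U : List α} (hU : U.Nodup)
    (h : (maximalRun M d.opp (U.take (4 * M))).length ≤
      (maximalRun M d (U.take (4 * M))).length) :
    (maximalRun M d.opp U).length ≤ (maximalRun M d U).length := by
  rcases Nat.lt_or_ge U.length (4 * M) with hlt | hge
  · rwa [List.take_of_length_le hlt.le] at h
  · have h₁ := min_length_maximalRun_take M d hge
    have h₂ := min_length_maximalRun_take M d.opp hge
    have h₃ := min_length_lt_of_opp hM hU (by omega) (maximalRun_sched M d hU)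
      (maximalRun_sched M d.opp hU) (maximalRun_pairwise M d U) (maximalRun_pairwise M d.opp U)
    -- Lengths capped at `3 * M` agree inside and outside the window, and one of the true lengths is
    -- below the cap, so the capped comparison decides the true one.
    omega

/-! ### Outputs of rounds can be produced with a buffer of size `M` -/

/-- The missing reads are inserted one at a time; when the input is exhausted there is nothing to
insert. -/
theorem Produces.fill {M : ℕ} {U S : List α} (h : Produces M (U.take M) (U.drop M) S) {k : ℕ}
    (hk : k ≤ M) : Produces M (U.take k) (U.drop k) S := by
  induction hk using Nat.decreasingInduction with
  | self => exact h
  | of_succ k hk ih =>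
    rcases Nat.lt_or_ge k U.length with hlt | hge
    · rw [List.drop_eq_getElem_cons hlt]
      refine .read (by rw [List.length_take]; omega) ?_
      rwa [← List.take_concat_get' U k hlt] at ih
    · rw [List.take_of_length_le hge, List.drop_of_length_le hge]
      rwa [List.take_of_length_le (by omega), List.drop_of_length_le (by omega)] at ih

theorem Produces.write_refill {M : ℕ} {U S : List α} {e : α} (he : e ∈ U.take M)
    (h : Produces M ((U.erase e).take M) ((U.erase e).drop M) S) :
    Produces M (U.take M) (U.drop M) (e :: S) := by
  have hM : 0 < M := Nat.pos_of_ne_zero fun h => by simp [h] at he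
  refine .write he ?_
  have h' := h.fill (k := (U.take M).length - 1) (by rw [List.length_take]; omega)
  have hsplit : U.erase e = (U.take M).erase e ++ U.drop M := by
    conv_lhs => rw [← List.take_append_drop M U]
    exact List.erase_append_left _ he
  have hlen := List.length_erase_of_mem he
  rwa [hsplit, ← hlen, List.take_left, List.drop_left] at h'

theorem Produces.append_maximalRunFrom {M : ℕ} {d : Dir} {n : ℕ} {last : Option α}
    {U S : List α} (h : Produces M ((U.diff (maximalRunFrom M d n last U)).take M)
      ((U.diff (maximalRunFrom M d n last U)).drop M) S) :
    Produces M (U.take M) (U.drop M) (maximalRunFrom M d n last U ++ S) := by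
  induction n generalizing last U with
  | zero => simpa [maximalRunFrom] using h
  | succ n ih =>
    rw [maximalRunFrom] at h ⊢
    cases hnext : d.next last (U.take M) with
    | none => simpa [hnext] using h
    | some e =>
      simp only [hnext, List.diff_cons] at h
      exact (ih h).write_refill (Dir.next_eq_some hnext).1

theorem GreedyTriples.produces {M : ℕ} {U S : List α} (h : GreedyTriples M U S) :
    Produces M [] U S := by
  suffices H : Produces M (U.take M) (U.drop M) S by simpa using H.fill (Nat.zero_le M)
  induction h with
  | done => simpa using Produces.done
  | round d _ _ _ ih =>
    rw [List.append_assoc, List.append_assoc]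
    exact ih.append_maximalRunFrom.append_maximalRunFrom.append_maximalRunFrom

/-! ### The algorithm -/

instance Dir.finite : Finite Dir :=
  Finite.of_injective (fun d : Dir => match d with | .up => true | .down => false)
    (by intro a b; cases a <;> cases b <;> simp)

/-- The direction of the greedy run, computed from the visible part `w`. -/
def greedyDir (M : ℕ) (w : List α) : Dir :=
  if (maximalRun M .down w).length ≤ (maximalRun M .up w).length then .up else .down

theorem greedyDir_spec (M : ℕ) (w : List α) :
    (maximalRun M (greedyDir M w).opp w).length ≤ (maximalRun M (greedyDir M w) w).length := by
  unfold greedyDir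
  split_ifs with h
  · exact h
  · exact (not_le.1 h).le

/-- The index in its round, and the direction, of the run that comes after a given run. -/
def nextRun (M : ℕ) (w : List α) : Fin 3 × Dir → Fin 3 × Dir
  | (0, d) => (1, d)
  | (1, d) => (2, d.opp)
  | (2, _) => (0, greedyDir M w)

/-- The run to which the next element belongs, and the last element of that run so far. -/
def currentRun (M : ℕ) (s : Option (Fin 3 × Dir)) (last : Option α) (w : List α) :
    (Fin 3 × Dir) × Option α :=
  match s with
  | none => ((0, greedyDir M w), none)
  | some k => if (k.2.next last (w.take M)).isSome then (k, last) else (nextRun M w k, none)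

/-- The next element to be written. -/
def nextElement (M : ℕ) (s : Option (Fin 3 × Dir)) (last : Option α) (w : List α) : Option α :=
  (currentRun M s last w).1.2.next (currentRun M s last w).2 (w.take M)

theorem nextElement_mem {M : ℕ} {s : Option (Fin 3 × Dir)} {last : Option α} {w : List α} {e : α}
    (h : nextElement M s last w = some e) : e ∈ w.take M :=
  (Dir.next_eq_some h).1

/-- The algorithm: rounds of a greedy run, a maximal run in the same direction, and a maximal run
in the opposite direction. -/
def roundAlgorithm (α : Type*) [LinearOrder α] (M : ℕ) (hM : 0 < M) :
    OnlineAlgorithm α (Option (Fin 3 × Dir)) M (4 * M) where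
  init := none
  next s last w := some (currentRun M s last w).1
  slot s last w :=
    match nextElement M s last w with
    -- A default that is never used on a nonempty window: a run that has just begun can always take
    -- an element.
    | none => 0
    | some e => (w.take M).idxOf e
  slot_lt s last w hw := by
    cases h : nextElement M s last w with
    | none =>
      have := List.length_pos_iff.2 hw
      simp only [List.length_take]
      omega
    | some e => exact List.idxOf_lt_length_of_mem (nextElement_mem h)

theorem roundAlgorithm_step {M : ℕ} (hM : 0 < M) {s : Option (Fin 3 × Dir)} {U W : List α}
    {k : Fin 3 × Dir} {last : Option α} {e : α}
    (hcur : currentRun M s W.getLast? (U.take (4 * M)) = (k, last))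
    (he : k.2.next last (U.take M) = some e) :
    (roundAlgorithm α M hM).step ⟨s, U, W⟩ = ⟨some k, U.erase e, W ++ [e]⟩ := by
  have htake : (U.take (4 * M)).take M = U.take M := by
    rw [List.take_take, min_eq_left (by omega)]
  have hnext : nextElement M s W.getLast? (U.take (4 * M)) = some e := by
    rw [nextElement, hcur, htake, he]
  have heB : e ∈ U.take M := htake ▸ nextElement_mem hnext
  have hidx : (U.take M).idxOf e = U.idxOf e := by
    conv_rhs => rw [← List.take_append_drop M U]
    rw [List.idxOf_append_of_mem heB]
  have hslot : (roundAlgorithm α M hM).slot s W.getLast? (U.take (4 * M)) = U.idxOf e := by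
    simp only [roundAlgorithm, hnext, htake, hidx]
  have heU : U[U.idxOf e]? = some e := by
    rw [List.getElem?_eq_getElem (List.idxOf_lt_length_of_mem (List.mem_of_mem_take heB)),
      List.getElem_idxOf]
  simp only [OnlineAlgorithm.step, hslot, heU, List.eraseIdx_idxOf_eq_erase]
  simp only [roundAlgorithm, hcur]

/-- The algorithm writes the rest of a maximal run. -/
theorem roundAlgorithm_iterate_run {M : ℕ} (hM : 0 < M) {k : Fin 3 × Dir} {n : ℕ}
    {s : Option (Fin 3 × Dir)} {U W : List α} {last : Option α} (hn : U.length ≤ n)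
    (hcur : currentRun M s W.getLast? (U.take (4 * M)) = (k, last))
    (hne : maximalRunFrom M k.2 n last U ≠ []) :
    ∃ l, (W ++ maximalRunFrom M k.2 n last U).getLast? = some l ∧
      k.2.next (some l) ((U.diff (maximalRunFrom M k.2 n last U)).take M) = none ∧
      (roundAlgorithm α M hM).step^[(maximalRunFrom M k.2 n last U).length] ⟨s, U, W⟩ =
        ⟨some k, U.diff (maximalRunFrom M k.2 n last U), W ++ maximalRunFrom M k.2 n last U⟩ := by
  induction n generalizing s U W last with
  | zero => exact absurd rfl hne
  | succ n ih =>
    rw [maximalRunFrom] at hne ⊢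
    cases he : k.2.next last (U.take M) with
    | none => simp [he] at hne
    | some e =>
      simp only
      have hstep := roundAlgorithm_step hM hcur he
      have hlen : (U.erase e).length ≤ n := by
        rw [List.length_erase_of_mem (List.mem_of_mem_take (Dir.next_eq_some he).1)]
        omega
      rw [List.length_cons, Function.iterate_succ_apply, hstep, List.diff_cons]
      rw [show W ++ e :: maximalRunFrom M k.2 n (some e) (U.erase e) =
        (W ++ [e]) ++ maximalRunFrom M k.2 n (some e) (U.erase e) by simp]
      -- The run ends exactly when the algorithm's own test fails on the refilled buffer; until then
      -- the state and the last written element identify the same run.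
      cases hnext : k.2.next (some e) ((U.erase e).take M) with
      | none =>
        have hnil : maximalRunFrom M k.2 n (some e) (U.erase e) = [] := by
          cases n with
          | zero => rfl
          | succ n => rw [maximalRunFrom, hnext]
        refine ⟨e, ?_, ?_, ?_⟩ <;> simp [hnil, hnext]
      | some e' =>
        refine ih hlen ?_ ?_
        · have htake : ((U.erase e).take (4 * M)).take M = (U.erase e).take M := by
            rw [List.take_take, min_eq_left (by omega)]
          simp [currentRun, htake, hnext]
        · cases n with
          | zero =>
            rw [List.length_eq_zero_iff.1 (Nat.le_zero.1 hlen)] at hnext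
            have := (Dir.next_eq_some hnext).1
            simp at this
          | succ n => simp [maximalRunFrom, hnext]

theorem maximalRun_ne_nil {M : ℕ} (hM : 0 < M) (d : Dir) {U : List α} (hU : U ≠ []) :
    maximalRun M d U ≠ [] := by
  obtain ⟨a, U, rfl⟩ := List.exists_cons_of_ne_nil hU
  rw [maximalRun, List.length_cons, maximalRunFrom]
  cases h : d.next none ((a :: U).take M) with
  | none =>
    obtain ⟨M, rfl⟩ := Nat.exists_eq_succ_of_ne_zero hM.ne'
    exact absurd (by simp) (Dir.next_eq_none.1 h a (by simp))
  | some e => simp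

/-- In this configuration, everything has been written, or the run `k` begins. -/
def StartsRun (M : ℕ) (k : Fin 3 × Dir) (c : Config α (Option (Fin 3 × Dir))) : Prop :=
  c.unwritten = [] ∨
    currentRun M c.state c.written.getLast? (c.unwritten.take (4 * M)) = (k, none)

/-- The algorithm writes a maximal run, and then starts the run that comes next. -/
theorem StartsRun.iterate {M : ℕ} (hM : 0 < M) {k : Fin 3 × Dir}
    {c : Config α (Option (Fin 3 × Dir))} (h : StartsRun M k c) :
    ∃ c', (roundAlgorithm α M hM).step^[(maximalRun M k.2 c.unwritten).length] c = c' ∧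
      c'.unwritten = afterRun M k.2 c.unwritten ∧
      c'.written = c.written ++ maximalRun M k.2 c.unwritten ∧
      StartsRun M (nextRun M (c'.unwritten.take (4 * M)) k) c' := by
  obtain ⟨s, U, W⟩ := c
  by_cases hU : U = []
  · subst hU
    exact ⟨_, rfl, rfl, (List.append_nil W).symm, Or.inl rfl⟩
  obtain ⟨l, hl, hnext, hstep⟩ := roundAlgorithm_iterate_run hM le_rfl
    (h.resolve_left hU) (maximalRun_ne_nil hM k.2 hU)
  refine ⟨_, hstep, rfl, rfl, Or.inr ?_⟩
  have htake : ∀ V : List α, (V.take (4 * M)).take M = V.take M := fun V => by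
    rw [List.take_take, min_eq_left (by omega)]
  simp only [currentRun, hl, htake, hnext]
  simp

theorem length_maximalRun_add_length_afterRun (M : ℕ) (d : Dir) {U : List α} (hU : U.Nodup) :
    (maximalRun M d U).length + (afterRun M d U).length = U.length := by
  have hs := maximalRun_sched M d hU
  have hperm := List.subperm_append_diff_self_of_count_le fun x _ =>
    (hs.1.subperm hs.subset).count_le x
  rw [afterRun, ← List.length_append, hperm.length_eq]

theorem StartsRun.greedyTriples {M : ℕ} (hM : 0 < M) {c : Config α (Option (Fin 3 × Dir))}
    (hU : c.unwritten.Nodup)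
    (h : StartsRun M (0, greedyDir M (c.unwritten.take (4 * M))) c) :
    ∃ T, GreedyTriples M c.unwritten T ∧
      ((roundAlgorithm α M hM).step^[c.unwritten.length] c).written = c.written ++ T := by
  induction hn : c.unwritten.length using Nat.strong_induction_on generalizing c with
  | _ n ih =>
    by_cases hne : c.unwritten = []
    · obtain rfl : n = 0 := by rw [← hn, hne, List.length_nil]
      exact ⟨[], by rw [hne]; exact .done, by simp⟩
    have hnd : ∀ (d : Dir) {U : List α}, U.Nodup → (afterRun M d U).Nodup := fun d U h => by
      rw [afterRun_eq_filter M d h]; exact h.filter _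
    set d := greedyDir M (c.unwritten.take (4 * M)) with hd
    obtain ⟨c₁, hc₁, hU₁, hW₁, h₁⟩ := h.iterate hM
    obtain ⟨c₂, hc₂, hU₂, hW₂, h₂⟩ := h₁.iterate hM
    obtain ⟨c₃, hc₃, hU₃, hW₃, h₃⟩ := h₂.iterate hM
    simp only [nextRun] at hc₁ hU₁ hW₁ hc₂ hU₂ hW₂ hc₃ hU₃ hW₃ h₃
    have hnd₁ := hnd d hU
    have hnd₂ := hnd d hnd₁
    have l₁ := length_maximalRun_add_length_afterRun M d hU
    have l₂ := length_maximalRun_add_length_afterRun M d hnd₁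
    have l₃ := length_maximalRun_add_length_afterRun M d.opp hnd₂
    have l₀ := List.length_pos_iff.2 (maximalRun_ne_nil hM d hne)
    rw [hU₁] at hc₂ hU₂ hW₂
    rw [hU₂] at hc₃ hU₃ hW₃
    -- The first run of the round is nonempty (`l₀`), so fewer elements remain, even if the other
    -- two runs are empty.
    obtain ⟨T, hT, hTW⟩ := ih c₃.unwritten.length (by rw [hU₃]; omega)
      (by rw [hU₃]; exact hnd _ hnd₂) h₃ rfl
    refine ⟨_, .round d hne (length_le_of_length_take_le hM hU (greedyDir_spec _ _)) (hU₃ ▸ hT), ?_⟩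
    have hsum : n = c₃.unwritten.length +
        ((maximalRun M d.opp (afterRun M d (afterRun M d c.unwritten))).length +
          ((maximalRun M d (afterRun M d c.unwritten)).length +
            (maximalRun M d c.unwritten).length)) := by
      rw [hU₃]; omega
    rw [hsum, Function.iterate_add_apply, Function.iterate_add_apply, Function.iterate_add_apply,
      hc₁, hc₂, hc₃, hTW, hW₃, hW₂, hW₁]
    simp

theorem roundAlgorithm_greedyTriples {M : ℕ} (hM : 0 < M) {I : List α} (hI : I.Nodup) :
    GreedyTriples M I ((roundAlgorithm α M hM).output I) := by
  obtain ⟨T, hT, hout⟩ := StartsRun.greedyTriples hM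
    (c := ⟨(roundAlgorithm α M hM).init, I, []⟩) hI (Or.inr rfl)
  rw [List.nil_append] at hout
  exact (show (roundAlgorithm α M hM).output I = T from hout) ▸ hT

end RunGeneration

theorem mainTheorem5 {α : Type*} [LinearOrder α] :
    ∃ (σ : Type) (_ : Finite σ), ∀ M : ℕ, 0 < M →
      ∃ A : RunGeneration.OnlineAlgorithm α σ M (4 * M), ∀ I : List α, I.Nodup →
        RunGeneration.Produces M [] I (A.output I) ∧
        RunGeneration.GreedyTriples M I (A.output I) ∧
        (RunGeneration.numRuns (A.output I) : ℝ) ≤ 3 / 2 * (RunGeneration.opt M I : ℝ) := by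
  refine ⟨Option (Fin 3 × RunGeneration.Dir), inferInstance, fun M hM =>
    ⟨RunGeneration.roundAlgorithm α M hM, fun I hI => ?_⟩⟩
  have h := RunGeneration.roundAlgorithm_greedyTriples hM hI
  exact ⟨h.produces, h, h.numRuns_le hI h.produces⟩
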